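/- Let $\mathrm{cov}(\mathcal M)$ be the smallest cardinality of a cover of the real line by meager sets, and assume that $\mathrm{cov}(\mathcal M)=\mathfrak c$, the cardinality of the continuum. For a semigroup $X$, let $X^0=X\cup\{0\}$ and $X^1=X\cup\{1\}$ be the semigroups obtained by adjoining a new element $0\notin X$ with $0x=0=x0$ for all $x\in X^0$, respectively a new element $1\notin X$ with $1x=x=x1$ for all $x\in X^1$. A semigroup topology on a semigroup is a topology making its binary operation (jointly) continuous. The semigroup $X$ is called zero-closed if $X$ is a closed subset of $X^0$ for every Hausdorff semigroup topology on $X^0$. It is called polybounded if there are finitely many elements $b_1,\dots,b_m\in X$ and functions $f_1,\dots,f_m:X\to X$ such that $X=\bigcup_{i=1}^m f_i^{-1}(b_i)$ and each $f_i$ has the form $f_i(x)=a_0xa_1x\cdots xa_n$ for some $n\ge 1$ and $a_0,\dots,a_n\in X^1$ (depending on $i$). A metric $d$ on $X$ is called subinvariant if $d(axb,ayb)\le d(x,y)$ for all $x,y\in X$ and $a,b\in X^1$. Then every zero-closed semigroup $X$ satisfying at least one of the following conditions is polybounded: 1. $X$ has a separable complete subinvariant metric; 2. $X$ admits a compact Hausdorff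 semigroup topology. -/

import Mathlib

universe u

/-- `X` is zero-closed: `X` is closed in its `0`-extension `X⁰ = X ∪ {0}` (Mathlib's `WithZero X`)
endowed with any Hausdorff topology making the multiplication of `X⁰` continuous. -/
def IsZeroClosed (X : Type u) [Semigroup X] : Prop :=
  ∀ _ : TopologicalSpace (WithZero X), T2Space (WithZero X) → ContinuousMul (WithZero X) →
    IsClosed (Set.range ((↑) : X → WithZero X))

/-- The product `a₀ x a₁ x ⋯ x aₙ`, computed in the `1`-extension `X¹ = X ∪ {1}` (Mathlib's
`WithOne X`). -/
def polyEval {X : Type u} [Semigroup X] {n : ℕ} (a : Fin (n + 1) → WithOne X) (x : X) :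
    WithOne X :=
  a 0 * (List.ofFn fun i : Fin n => (x : WithOne X) * a i.succ).prod

/-- `f : X → X` is a semigroup polynomial: `f x = a₀ x a₁ x ⋯ x aₙ` for some `n ≥ 1` and
coefficients `a₀, …, aₙ ∈ X¹`. -/
def IsSemigroupPolynomial {X : Type u} [Semigroup X] (f : X → X) : Prop :=
  ∃ n : ℕ, 1 ≤ n ∧ ∃ a : Fin (n + 1) → WithOne X, ∀ x : X, (f x : WithOne X) = polyEval a x

/-- `X` is polybounded: it is the union of finitely many sets `fᵢ⁻¹(bᵢ)`, where `bᵢ ∈ X` and the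
`fᵢ` are semigroup polynomials on `X`. -/
def IsPolybounded (X : Type u) [Semigroup X] : Prop :=
  ∃ (n : ℕ) (f : Fin n → X → X) (b : Fin n → X),
    (∀ i, IsSemigroupPolynomial (f i)) ∧ ⋃ i, f i ⁻¹' {b i} = Set.univ

/-- The metric of `X` is subinvariant: `d(axb, ayb) ≤ d(x, y)` for all `x, y ∈ X` and
`a, b ∈ X¹`. Here `x'` and `y'` are the elements `axb` and `ayb` of `X`, the products being
computed in `X¹`. -/
def IsSubinvariantDist (X : Type u) [Semigroup X] [MetricSpace X] : Prop :=
  ∀ (a b : WithOne X) (x y x' y' : X),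
    (x' : WithOne X) = a * x * b → (y' : WithOne X) = a * y * b → dist x' y' ≤ dist x y

/-- `X` has a separable complete subinvariant metric. -/
def HasSeparableCompleteSubinvariantMetric (X : Type u) [Semigroup X] : Prop :=
  ∃ _ : MetricSpace X,
    TopologicalSpace.SeparableSpace X ∧ CompleteSpace X ∧ IsSubinvariantDist X

/-- `X` admits a compact Hausdorff semigroup topology. -/
def AdmitsCompactHausdorffSemigroupTopology (X : Type u) [Semigroup X] : Prop :=
  ∃ _ : TopologicalSpace X, CompactSpace X ∧ T2Space X ∧ ContinuousMul X

/-- `cov(M)`: the smallest cardinality of a cover of the real line by meager sets. -/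
noncomputable def covMeager : Cardinal.{0} :=
  sInf {κ | ∃ C : Set (Set ℝ), (∀ s ∈ C, IsMeagre s) ∧ ⋃₀ C = Set.univ ∧ Cardinal.mk C = κ}

/-!
A proper filter `F` on `X` which is stable under translations, satisfies `F * F ≤ F` and has no
cluster point in the discrete space `X` is the trace on `X` of the neighborhood filter of `0` in a
Hausdorff semigroup topology on `X⁰`, so that a zero-closed semigroup carries no such filter.
Filters are produced by recursion: each new generic element avoids few polynomial equations in the
previous ones, and the sets generating `F` consist of products dominated by a late generic element.

Run transfinitely, the recursion can only stop at a cover of `X` by fewer than `𝔠` polynomial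
equations. If `X` is Polish and `cov(ℳ) = 𝔠`, Baire category for fewer than `𝔠` closed sets, in the
form of `MA(countable)`, then yields, inside any closed ideal of `X`, an open set on which
some polynomial is constant. Hence every point is sent by a polynomial into one of countably many
open sets `B j`, each meeting some ideal in a set on which a polynomial is constant.

If `X` is not polybounded, finitely many polynomial preimages of the sets `B j` never cover `X`, so
the recursion of length `ω` gives a filter of words avoiding every `B j`; translations by a dense
sequence being controlled by the weights of the words, thickening this filter in the subinvariant
metric makes it stable under all translations, a contradiction.

For a compact semigroup that is not polybounded, compactness of `X ^ ℕ` yields countably many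
continuous functions witnessing that no finite system of equations, with any constants, covers `X`.
Recording their values along orbits defines a metrizable quotient with a subinvariant metric, which
is still not polybounded and inherits the absence of such filters.
-/

universe v

open Filter Topology Set
open Cardinal hiding univ
open FreeSemigroup (toFreeMonoid)

section FreeSemigroup

variable {α β M : Type*} [Semigroup M]

theorem freeSemigroup_lift_congr {f g : α → M} {u : FreeSemigroup α}
    (h : ∀ c ∈ toFreeMonoid u, f c = g c) :
    FreeSemigroup.lift f u = FreeSemigroup.lift g u := by
  induction u using FreeSemigroup.recOnMul with
  | ih1 c => exact h c (by simp)
  | ih2 c u ih₁ ih₂ =>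
    simp only [map_mul, FreeMonoid.mem_mul] at h ⊢
    rw [ih₁ fun c hc => h c (.inl hc), ih₂ fun c hc => h c (.inr hc)]

theorem freeSemigroup_lift_map (f : β → M) (g : α → β) (u : FreeSemigroup α) :
    FreeSemigroup.lift f (FreeSemigroup.map g u) = FreeSemigroup.lift (f ∘ g) u :=
  DFunLike.congr_fun (FreeSemigroup.hom_ext rfl :
    (FreeSemigroup.lift f).comp (FreeSemigroup.map g) = FreeSemigroup.lift (f ∘ g)) u

theorem toFreeMonoid_freeSemigroup_map (f : α → β) (u : FreeSemigroup α) :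
    toFreeMonoid (FreeSemigroup.map f u) = FreeMonoid.map f (toFreeMonoid u) := by
  induction u using FreeSemigroup.recOnMul with
  | ih1 c => rfl
  | ih2 c u ih₁ ih₂ => simp only [map_mul, ih₁, ih₂]

theorem mem_range_freeSemigroup_map_iff {f : α → β} {u : FreeSemigroup β} :
    u ∈ range (FreeSemigroup.map f) ↔ ∀ c ∈ toFreeMonoid u, c ∈ range f := by
  constructor
  · rintro ⟨v, rfl⟩ c hc
    rw [toFreeMonoid_freeSemigroup_map, FreeMonoid.mem_map] at hc
    exact hc.imp fun _ => And.right
  · intro h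
    induction u using FreeSemigroup.recOnMul with
    | ih1 c =>
      obtain ⟨d, rfl⟩ := h c (by simp)
      exact ⟨.of d, rfl⟩
    | ih2 c u ih₁ ih₂ =>
      simp only [map_mul, FreeMonoid.mem_mul] at h
      obtain ⟨v, hv⟩ := ih₁ fun c hc => h c (.inl hc)
      obtain ⟨w, hw⟩ := ih₂ fun c hc => h c (.inr hc)
      exact ⟨v * w, by rw [map_mul, hv, hw]⟩

theorem mk_freeSemigroup_le_max (α : Type u) : #(FreeSemigroup α) ≤ max ℵ₀ #α :=
  (mk_le_of_injective FreeSemigroup.toFreeMonoid_injective).trans (mk_list_le_max α)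

instance [Countable α] : Countable (FreeSemigroup α) :=
  (FreeSemigroup.toFreeMonoid_injective.countable : _)

theorem coe_freeSemigroup_lift (f : α → M) (u : FreeSemigroup α) :
    ((FreeSemigroup.lift f u : M) : WithOne M) =
      FreeMonoid.lift (fun c => (f c : WithOne M)) (toFreeMonoid u) := by
  induction u using FreeSemigroup.recOnMul with
  | ih1 c => simp
  | ih2 c u ih₁ ih₂ => simp only [map_mul, WithOne.coe_mul, ih₁, ih₂]

end FreeSemigroup

/-- Words in a variable, the letter `none`, and constants from `α`: formal semigroup polynomials. -/
abbrev PolyWord (α : Type*) := FreeSemigroup (Option α)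

namespace PolyWord

variable {α β M N : Type*} [Semigroup M] [Semigroup N]

/-- The variable occurs in the word. -/
def HasVar (w : PolyWord α) : Prop := none ∈ toFreeMonoid w

/-- The value of a word at `x`, the constants being interpreted through `g`. -/
def ev (g : α → M) (w : PolyWord α) (x : M) : M :=
  FreeSemigroup.lift (fun o : Option α => o.elim x g) w

/-- The word consisting of the variable. -/
def var : PolyWord α := FreeSemigroup.of none

/-- The word consisting of a constant. -/
def const (c : α) : PolyWord α := FreeSemigroup.of (some c)

@[simp]
theorem ev_var (g : α → M) (x : M) : ev g var x = x := rfl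

@[simp]
theorem ev_const (g : α → M) (c : α) (x : M) : ev g (const c) x = g c := rfl

@[simp]
theorem ev_mul (g : α → M) (v w : PolyWord α) (x : M) : ev g (v * w) x = ev g v x * ev g w x :=
  map_mul _ v w

@[simp]
theorem hasVar_var : HasVar (var : PolyWord α) := by simp [HasVar, var]

@[simp]
theorem not_hasVar_const (c : α) : ¬ HasVar (const c : PolyWord α) := by simp [HasVar, const]

@[simp]
theorem hasVar_mul {v w : PolyWord α} : HasVar (v * w) ↔ HasVar v ∨ HasVar w := by
  simp [HasVar]

@[elab_as_elim]
theorem induction {C : PolyWord α → Prop} (w : PolyWord α) (var : C var)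
    (const : ∀ c, C (const c)) (mul : ∀ v w, C v → C w → C (v * w)) : C w := by
  induction w using FreeSemigroup.recOnMul with
  | ih1 o => cases o with
    | none => exact var
    | some c => exact const c
  | ih2 o w h ih => exact mul _ _ h ih

theorem map_ev (π : M →ₙ* N) (g : α → M) (w : PolyWord α) (x : M) :
    π (ev g w x) = ev (π ∘ g) w (π x) := by
  induction w using induction with
  | var => rfl
  | const c => rfl
  | mul v w hv hw => simp only [ev_mul, map_mul, hv, hw]

/-- Renaming of the constants of a word. -/
def rename (f : α → β) (w : PolyWord α) : PolyWord β := FreeSemigroup.map (Option.map f) w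

theorem ev_rename (g : β → M) (f : α → β) (w : PolyWord α) (x : M) :
    ev g (rename f w) x = ev (g ∘ f) w x := by
  rw [ev, rename, freeSemigroup_lift_map]
  exact freeSemigroup_lift_congr fun o _ => by cases o <;> rfl

theorem hasVar_rename (f : α → β) (w : PolyWord α) : HasVar (rename f w) ↔ HasVar w := by
  simp [HasVar, rename, toFreeMonoid_freeSemigroup_map, FreeMonoid.mem_map]

/-- Substitution of a word for the variable. -/
def subst (w p : PolyWord α) : PolyWord α := ev const w p

theorem ev_subst (g : α → M) (w p : PolyWord α) (x : M) :
    ev g (subst w p) x = ev g w (ev g p x) := by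
  induction w using induction with
  | var => rfl
  | const c => rfl
  | mul v w hv hw => simp only [subst, ev_mul] at hv hw ⊢; rw [hv, hw]

theorem HasVar.subst {w p : PolyWord α} (hw : HasVar w) (hp : HasVar p) : HasVar (subst w p) := by
  induction w using induction with
  | var => exact hp
  | const c => exact absurd hw (not_hasVar_const c)
  | mul v w ihv ihw =>
    rw [PolyWord.subst, ev_mul, hasVar_mul]
    exact (hasVar_mul.1 hw).imp ihv ihw

theorem continuous_ev [TopologicalSpace M] [ContinuousMul M] (w : PolyWord α) :
    Continuous fun p : (α → M) × M => ev p.1 w p.2 := by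
  induction w using induction with
  | var => exact continuous_snd
  | const c => exact (continuous_apply c).comp continuous_fst
  | mul v w hv hw => simp only [ev_mul]; exact hv.mul hw

theorem continuous_ev_right [TopologicalSpace M] [ContinuousMul M] (g : α → M) (w : PolyWord α) :
    Continuous fun x : M => ev g w x :=
  (continuous_ev w).comp (by fun_prop : Continuous fun x : M => (g, x))

theorem exists_polyEval {X : Type*} [Semigroup X] (m : FreeMonoid (Option X)) :
    ∃ (n : ℕ) (a : Fin (n + 1) → WithOne X), (none ∈ m → 1 ≤ n) ∧
      ∀ x : X, FreeMonoid.lift (fun o => ((o.elim x id : X) : WithOne X)) m = polyEval a x := by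
  induction m using FreeMonoid.inductionOn' with
  | one => exact ⟨0, fun _ => 1, fun h => absurd h FreeMonoid.notMem_one, by simp [polyEval]⟩
  | of_mul o m ih =>
    obtain ⟨n, a, hn, ha⟩ := ih
    cases o with
    | none => exact ⟨n + 1, Fin.cons 1 a, fun _ => n.succ_pos, fun x => by
        simp [polyEval, ha, List.ofFn_succ, mul_assoc]⟩
    | some c => exact ⟨n, Function.update a 0 (c * a 0), by simpa [FreeMonoid.mem_mul] using hn,
        fun x => by simp [polyEval, ha, mul_assoc]⟩

theorem HasVar.isSemigroupPolynomial {X : Type u} [Semigroup X] {w : PolyWord X}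
    (hw : HasVar w) : IsSemigroupPolynomial (ev id w) := by
  obtain ⟨n, a, hn, ha⟩ := exists_polyEval (toFreeMonoid w)
  exact ⟨n, hn hw, a, fun x => (coe_freeSemigroup_lift _ w).trans (ha x)⟩

end PolyWord

open PolyWord

section PolyCover

variable {α M : Type*} [Semigroup M]

/-- The solution sets of the polynomial equations `w = c`, for `(w, c) ∈ σ`, cover `M` when the
constants are interpreted through `g`. -/
def IsPolyCover (g : α → M) (σ : Set (PolyWord α × α)) : Prop :=
  (∀ p ∈ σ, HasVar p.1) ∧ ∀ x, ∃ p ∈ σ, ev g p.1 x = g p.2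

/-- Polyboundedness in terms of formal polynomials. -/
def IsWordBounded (M : Type*) [Semigroup M] : Prop :=
  ∃ σ : Set (PolyWord M × M), σ.Finite ∧ IsPolyCover id σ

theorem IsWordBounded.isPolybounded {X : Type u} [Semigroup X] (h : IsWordBounded X) :
    IsPolybounded X := by
  obtain ⟨σ, hσ, hvar, hcover⟩ := h
  have := hσ.to_subtype
  obtain ⟨n, ⟨e⟩⟩ := Finite.exists_equiv_fin σ
  refine ⟨n, fun i => ev id (e.symm i).1.1, fun i => (e.symm i).1.2,
    fun i => (hvar _ (e.symm i).2).isSemigroupPolynomial, eq_univ_of_forall fun x => ?_⟩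
  obtain ⟨p, hp, hx⟩ := hcover x
  exact mem_iUnion.2 ⟨e ⟨p, hp⟩, by simpa using hx⟩

theorem isPolyCover_id_image_iff {g : α → M} {σ : Set (PolyWord α × α)} :
    IsPolyCover id (Prod.map (rename g) g '' σ) ↔ IsPolyCover g σ := by
  simp only [IsPolyCover, forall_mem_image, exists_mem_image, Prod.map_fst, Prod.map_snd,
    hasVar_rename, ev_rename, Function.id_comp, id_eq]

theorem IsPolyCover.isWordBounded {g : α → M} {σ : Set (PolyWord α × α)} (h : IsPolyCover g σ)
    (hσ : σ.Finite) : IsWordBounded M :=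
  ⟨_, hσ.image _, isPolyCover_id_image_iff.2 h⟩

theorem IsWordBounded.exists_isPolyCover_nat [Nonempty M] (h : IsWordBounded M) :
    ∃ (g : ℕ → M) (σ : Set (PolyWord ℕ × ℕ)), σ.Finite ∧ IsPolyCover g σ := by
  obtain ⟨τ, hτ, hcover⟩ := h
  let constants : Set M := ⋃ p ∈ τ, insert p.2 {c | some c ∈ toFreeMonoid p.1}
  have hconstants : constants.Countable := hτ.countable.biUnion fun p _ =>
    (((List.finite_toSet (toFreeMonoid p.1).toList).preimage
      (Option.some_injective M).injOn).insert p.2).countable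
  obtain ⟨g, hg⟩ : ∃ g : ℕ → M, constants ⊆ range g :=
    countable_iff_exists_subset_range.1 hconstants
  obtain ⟨σ, -, hσ, rfl⟩ : ∃ σ ⊆ univ, σ.Finite ∧ Prod.map (rename g) g '' σ = τ := by
    refine (exists_subset_image_finite_and (p := (· = τ))).1 ⟨τ, fun p hp => ?_, hτ, rfl⟩
    have hp' : insert p.2 {c | some c ∈ toFreeMonoid p.1} ⊆ range g :=
      (subset_biUnion_of_mem hp).trans hg
    obtain ⟨w, hw⟩ : p.1 ∈ range (rename g) := mem_range_freeSemigroup_map_iff.2 fun o ho => by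
      cases o with
      | none => exact ⟨none, rfl⟩
      | some c =>
        obtain ⟨k, rfl⟩ := hp' (mem_insert_of_mem _ ho)
        exact ⟨some k, rfl⟩
    obtain ⟨k, hk⟩ := hp' (mem_insert _ _)
    exact ⟨(w, k), mem_univ _, Prod.ext hw hk⟩
  exact ⟨g, σ, hσ, isPolyCover_id_image_iff.1 hcover⟩

end PolyCover

section Absorbing

variable {M N : Type*} [Semigroup M] [Semigroup N] {F : Filter M} {T : Set M}

/-- `F` is preserved by the translations by elements of `T`, and `F * F ≤ F`: what the trace on `M`
of the neighborhood filter of a zero satisfies with `T = univ`. -/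
structure IsAbsorbing (F : Filter M) (T : Set M) : Prop where
  mul_left : ∀ a ∈ T, Tendsto (a * ·) F F
  mul_right : ∀ a ∈ T, Tendsto (· * a) F F
  mul : Tendsto (fun p : M × M => p.1 * p.2) (F ×ˢ F) F

theorem IsAbsorbing.map (hF : IsAbsorbing F T) (π : M →ₙ* N) :
    IsAbsorbing (F.map π) (π '' T) where
  mul_left := by
    rintro _ ⟨a, ha, rfl⟩
    exact tendsto_map'_iff.2 ((tendsto_map.comp (hF.mul_left a ha)).congr fun x => map_mul π a x)
  mul_right := by
    rintro _ ⟨a, ha, rfl⟩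
    exact tendsto_map'_iff.2 ((tendsto_map.comp (hF.mul_right a ha)).congr fun x => map_mul π x a)
  mul := by
    rw [prod_map_map_eq, tendsto_map'_iff]
    exact (tendsto_map.comp hF.mul).congr fun p => map_mul π p.1 p.2

theorem IsAbsorbing.comap {F : Filter N} {T : Set N} (hF : IsAbsorbing F T) (π : M →ₙ* N) :
    IsAbsorbing (F.comap π) (π ⁻¹' T) where
  mul_left a ha := tendsto_comap_iff.2 <|
    ((hF.mul_left (π a) ha).comp tendsto_comap).congr fun x => (map_mul π a x).symm
  mul_right a ha := tendsto_comap_iff.2 <|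
    ((hF.mul_right (π a) ha).comp tendsto_comap).congr fun x => (map_mul π x a).symm
  mul := tendsto_comap_iff.2 <|
    (hF.mul.comp (tendsto_comap.prodMap tendsto_comap)).congr fun p => (map_mul π p.1 p.2).symm

theorem IsAbsorbing.tendsto_ev (hF : IsAbsorbing F univ) {w : PolyWord M} (hw : HasVar w) :
    Tendsto (ev id w) F F := by
  suffices H : ∀ w : PolyWord M, (HasVar w ∧ Tendsto (ev id w) F F) ∨
      (¬ HasVar w ∧ ∃ c, ∀ x, ev id w x = c) from ((H w).resolve_right fun h => h.1 hw).2
  intro w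
  induction w using induction with
  | var => exact .inl ⟨hasVar_var, tendsto_id⟩
  | const c => exact .inr ⟨not_hasVar_const c, c, fun x => rfl⟩
  | mul v w hv hw =>
    rcases hv with ⟨hv, tv⟩ | ⟨hv, c, hc⟩ <;> rcases hw with ⟨hw, tw⟩ | ⟨hw, d, hd⟩
    · exact .inl ⟨hasVar_mul.2 (.inl hv), (hF.mul.comp (tv.prodMk tw)).congr fun x => by simp⟩
    · exact .inl ⟨hasVar_mul.2 (.inl hv),
        ((hF.mul_right d trivial).comp tv).congr fun x => by simp [hd]⟩
    · exact .inl ⟨hasVar_mul.2 (.inr hw),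
        ((hF.mul_left c trivial).comp tw).congr fun x => by simp [hc]⟩
    · exact .inr ⟨by simp [hv, hw], c * d, fun x => by simp [hc, hd]⟩

theorem isAbsorbing_iInf_principal {I : Type*} [SemilatticeSup I] [Nonempty I] {W : I → Set M}
    (hW : Antitone W) (hleft : ∀ a ∈ T, ∀ i, ∃ j, ∀ u ∈ W j, a * u ∈ W i)
    (hright : ∀ a ∈ T, ∀ i, ∃ j, ∀ u ∈ W j, u * a ∈ W i)
    (hmul : ∀ i, ∃ j, ∀ u ∈ W j, ∀ v ∈ W j, u * v ∈ W i) :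
    IsAbsorbing (⨅ i, 𝓟 (W i)) T := by
  have hbasis := hasBasis_iInf_principal hW.directed_ge
  refine ⟨fun a ha => (hbasis.tendsto_iff hbasis).2 fun i _ => ?_,
    fun a ha => (hbasis.tendsto_iff hbasis).2 fun i _ => ?_,
    (hbasis.prod_self.tendsto_iff hbasis).2 fun i _ => ?_⟩
  · exact (hleft a ha i).imp fun j hj => ⟨trivial, hj⟩
  · exact (hright a ha i).imp fun j hj => ⟨trivial, hj⟩
  · exact (hmul i).imp fun j hj => ⟨trivial, fun p hp => hj _ hp.1 _ hp.2⟩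

/-- The traces on `M` of the neighborhood filters of `0` in the non-discrete Hausdorff semigroup
topologies on `M⁰` for which the points of `M` are isolated. -/
structure IsVanishing (F : Filter M) : Prop where
  neBot : F.NeBot
  isAbsorbing : IsAbsorbing F univ
  compl_singleton_mem : ∀ a, {a}ᶜ ∈ F

theorem IsVanishing.comap {F : Filter N} (hF : IsVanishing F) (π : M →ₙ* N)
    (hπ : Function.Surjective π) : IsVanishing (F.comap π) where
  neBot := hF.neBot.comap_of_surj hπ
  isAbsorbing := hF.isAbsorbing.comap π
  compl_singleton_mem a :=
    ⟨{π a}ᶜ, hF.compl_singleton_mem _, fun _ hx h => hx (congrArg π (mem_singleton_iff.1 h))⟩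

end Absorbing

section ZeroClosed

variable {X : Type u}

theorem nhdsAdjoint_zero_zero (F : Filter X) :
    @nhds _ (nhdsAdjoint (0 : WithZero X) (F.map (↑))) 0 = pure 0 ⊔ F.map (↑) :=
  nhds_nhdsAdjoint_same _ _

theorem nhdsAdjoint_zero_coe (F : Filter X) (x : X) :
    @nhds _ (nhdsAdjoint (0 : WithZero X) (F.map (↑))) x = pure ↑x :=
  nhds_nhdsAdjoint_of_ne _ WithZero.coe_ne_zero

theorem t2Space_nhdsAdjoint_zero {F : Filter X} (hF : ∀ a, {a}ᶜ ∈ F) :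
    @T2Space _ (nhdsAdjoint (0 : WithZero X) (F.map (↑))) := by
  let _ := nhdsAdjoint (0 : WithZero X) (F.map (↑))
  have hdisj (x : X) : Disjoint (𝓝 (x : WithZero X)) (𝓝 0) := by
    rw [nhdsAdjoint_zero_coe, nhdsAdjoint_zero_zero, disjoint_sup_right, disjoint_pure_pure,
      ← principal_singleton, disjoint_principal_left, mem_map]
    exact ⟨WithZero.coe_ne_zero,
      mem_of_superset (hF x) fun y hy hyx => hy (WithZero.coe_inj.1 hyx)⟩
  refine t2Space_iff_disjoint_nhds.2 fun a b hab => ?_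
  induction a using WithZero.recZeroCoe with
  | zero =>
    obtain ⟨b, rfl⟩ := WithZero.ne_zero_iff_exists.1 hab.symm
    exact (hdisj b).symm
  | coe a =>
    induction b using WithZero.recZeroCoe with
    | zero => exact hdisj a
    | coe b => simpa only [nhdsAdjoint_zero_coe, disjoint_pure_pure] using hab

open Pointwise in
theorem continuousMul_nhdsAdjoint_zero [Semigroup X] {F : Filter X} (hF : IsAbsorbing F univ) :
    @ContinuousMul _ (nhdsAdjoint (0 : WithZero X) (F.map (↑))) _ := by
  let _ := nhdsAdjoint (0 : WithZero X) (F.map (↑))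
  let G : Filter (WithZero X) := F.map (↑)
  have hG : IsAbsorbing G (range ((↑) : X → WithZero X)) := by
    rw [← image_univ]
    exact hF.map ⟨((↑) : X → WithZero X), WithZero.coe_mul⟩
  have pure_zero_mul (H : Filter (WithZero X)) : pure 0 * H ≤ pure 0 := by
    simp only [pure_mul, zero_mul]
    exact tendsto_const_pure
  have mul_pure_zero (H : Filter (WithZero X)) : H * pure 0 ≤ pure 0 := by
    simp only [mul_pure, mul_zero]
    exact tendsto_const_pure
  have mul_le : G * G ≤ G := by simpa only [Tendsto, map_prod_eq_map₂, map₂_mul] using hG.mul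
  refine ⟨continuous_iff_continuousAt.2 fun ⟨a, b⟩ => ?_⟩
  suffices 𝓝 a * 𝓝 b ≤ 𝓝 (a * b) by
    rwa [ContinuousAt, nhds_prod_eq, Tendsto, map_prod_eq_map₂, map₂_mul]
  induction a using WithZero.recZeroCoe with
  | zero =>
    induction b using WithZero.recZeroCoe with
    | zero =>
      simp only [zero_mul, nhdsAdjoint_zero_zero, ← map₂_mul, map₂_sup_left, map₂_sup_right]
      exact sup_le (le_sup_of_le_left (sup_le (pure_zero_mul _) (mul_pure_zero _)))
        (sup_le_sup (pure_zero_mul _) mul_le)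
    | coe b =>
      simp only [zero_mul, nhdsAdjoint_zero_zero, nhdsAdjoint_zero_coe, ← map₂_mul, map₂_sup_left]
      exact sup_le_sup (pure_zero_mul _) (mul_pure.le.trans (hG.mul_right b ⟨b, rfl⟩))
  | coe a =>
    induction b using WithZero.recZeroCoe with
    | zero =>
      simp only [mul_zero, nhdsAdjoint_zero_zero, nhdsAdjoint_zero_coe, ← map₂_mul, map₂_sup_right]
      exact sup_le_sup (mul_pure_zero _) (pure_mul.le.trans (hG.mul_left a ⟨a, rfl⟩))
    | coe b => simp only [← WithZero.coe_mul, nhdsAdjoint_zero_coe, pure_mul_pure, le_refl]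

theorem IsVanishing.not_isZeroClosed [Semigroup X] {F : Filter X} (hF : IsVanishing F) :
    ¬ IsZeroClosed X := by
  intro hX
  let _ := nhdsAdjoint (0 : WithZero X) (F.map (↑))
  have hclosed := hX _ (t2Space_nhdsAdjoint_zero hF.compl_singleton_mem)
    (continuousMul_nhdsAdjoint_zero hF.isAbsorbing)
  have hmem : (range ((↑) : X → WithZero X))ᶜ ∈ 𝓝 0 :=
    hclosed.isOpen_compl.mem_nhds fun ⟨_, hx⟩ => WithZero.coe_ne_zero hx
  rw [nhdsAdjoint_zero_zero] at hmem
  have := hF.neBot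
  obtain ⟨x, hx⟩ := F.nonempty_of_mem hmem.2
  exact hx ⟨x, rfl⟩

end ZeroClosed

section GenericSequence

open scoped Classical in
/-- The word `u` as a polynomial in its letter `l`, the other letters being interpreted through
`g`. -/
noncomputable def PolyWord.ofLetter {α M : Type*} (g : α → M) (l : α) (u : FreeSemigroup α) :
    PolyWord M :=
  FreeSemigroup.map (fun c => if c = l then none else some (g c)) u

theorem hasVar_ofLetter {α M : Type*} {g : α → M} {l : α} {u : FreeSemigroup α} :
    HasVar (ofLetter g l u) ↔ l ∈ toFreeMonoid u := by
  simp [HasVar, ofLetter, toFreeMonoid_freeSemigroup_map, FreeMonoid.mem_map]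

theorem ev_ofLetter {α M : Type*} [DecidableEq α] [Semigroup M] (g : α → M) (l : α)
    (u : FreeSemigroup α) (y : M) :
    ev id (ofLetter g l u) y = FreeSemigroup.lift (Function.update g l y) u := by
  rw [ev, ofLetter, freeSemigroup_lift_map]
  refine freeSemigroup_lift_congr fun c _ => ?_
  by_cases hc : c = l <;> simp [hc]

variable {I M : Type*} [LinearOrder I]

theorem exists_forall_of_exists_update [WellFoundedLT I] [Nonempty M] {P : I → (I → M) → Prop}
    (hP : ∀ i f g, EqOn f g (Iic i) → P i f → P i g)
    (h : ∀ i f, ∃ y, P i (Function.update f i y)) : ∃ x, ∀ i, P i x := by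
  choose y hy using h
  let next (i : I) (x : ∀ j < i, M) : M :=
    y i fun j => if hj : j < i then x j hj else Classical.arbitrary M
  let x : I → M := wellFounded_lt.fix next
  refine ⟨x, fun i => hP i _ _ ?_ (hy i fun j => if _ : j < i then x j else Classical.arbitrary M)⟩
  intro j hj
  rcases hj.lt_or_eq with hj | rfl
  · rw [Function.update_of_ne hj.ne, dif_pos hj]
  · rw [Function.update_self]
    exact (wellFounded_lt.fix_eq next j).symm

/-- Among the letters `inr j` of `u`, which stand for generic elements, the one with the largest
index is `inr k`. The letters `inl i` stand for given elements. -/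
def IsLeading (k : I) (u : FreeSemigroup (I ⊕ I)) : Prop :=
  .inr k ∈ toFreeMonoid u ∧ ∀ j, .inr j ∈ toFreeMonoid u → j ≤ k

theorem isLeading_of_inr (k : I) : IsLeading k (.of (.inr k)) := by
  simp [IsLeading]

theorem IsLeading.mul {k l : I} {u v : FreeSemigroup (I ⊕ I)} (hu : IsLeading k u)
    (hv : IsLeading l v) : IsLeading (max k l) (u * v) := by
  simp only [IsLeading, map_mul, FreeMonoid.mem_mul]
  refine ⟨?_, fun j hj => hj.elim (fun h => (hu.2 j h).trans (le_max_left k l))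
    fun h => (hv.2 j h).trans (le_max_right k l)⟩
  rcases max_choice k l with h | h <;> rw [h]
  exacts [.inl hu.1, .inr hv.1]

theorem IsLeading.of_inl_mul {k : I} {u : FreeSemigroup (I ⊕ I)} (hu : IsLeading k u) (i : I) :
    IsLeading k (.of (.inl i) * u) := by
  simpa [IsLeading] using hu

theorem IsLeading.mul_of_inl {k : I} {u : FreeSemigroup (I ⊕ I)} (hu : IsLeading k u) (i : I) :
    IsLeading k (u * .of (.inl i)) := by
  simpa [IsLeading] using hu

theorem exists_forall_lift_notMem [Semigroup M] [WellFoundedLT I] [Nonempty M] (a : I → M)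
    {V : I → Set (FreeSemigroup (I ⊕ I))} {bad : I → Set M} (hV : ∀ k, ∀ u ∈ V k, IsLeading k u)
    (h : ∀ k (p : V k → PolyWord M), (∀ u, HasVar (p u)) → ∃ y, ∀ u, ev id (p u) y ∉ bad k) :
    ∃ x : I → M, ∀ k, ∀ u ∈ V k, FreeSemigroup.lift (Sum.elim a x) u ∉ bad k := by
  refine exists_forall_of_exists_update (fun k f g hfg hf u hu => ?_) fun k f => ?_
  · rw [← freeSemigroup_lift_congr (f := Sum.elim a f)]
    · exact hf u hu
    · rintro (i | j) hj
      exacts [rfl, hfg ((hV k u hu).2 j hj)]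
  · obtain ⟨y, hy⟩ := h k (fun u => ofLetter (Sum.elim a f) (.inr k) u)
      fun u => hasVar_ofLetter.2 (hV k u u.2).1
    refine ⟨y, fun u hu => ?_⟩
    rw [← Sum.update_elim_inr, ← ev_ofLetter]
    exact hy ⟨u, hu⟩

end GenericSequence

section SmallCover

/-- The words with leading letter `inr k` whose letters `inl i` have index `i < k`. -/
def boundedWords {I : Type*} [LinearOrder I] (k : I) : Set (FreeSemigroup (I ⊕ I)) :=
  {u | IsLeading k u ∧ ∀ i, .inl i ∈ toFreeMonoid u → i < k}

theorem antitone_iUnion_boundedWords {I : Type*} [LinearOrder I] :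
    Antitone fun n : I => ⋃ k ≥ n, boundedWords k :=
  fun _ _ hmn => biUnion_subset_biUnion_left fun _ hk => hmn.trans hk

theorem isAbsorbing_boundedWords {I : Type*} [LinearOrder I] [NoMaxOrder I] [Nonempty I] :
    IsAbsorbing (⨅ n : I, 𝓟 (⋃ k ≥ n, boundedWords k)) (range fun i => .of (.inl i)) := by
  refine isAbsorbing_iInf_principal antitone_iUnion_boundedWords ?_ ?_ fun n => ⟨n, ?_⟩
  · rintro _ ⟨i, rfl⟩ n
    obtain ⟨m, hm⟩ := exists_gt (max i n)
    refine ⟨m, fun u hu => ?_⟩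
    obtain ⟨k, hk, hlead, hlt⟩ := mem_iUnion₂.1 hu
    obtain ⟨hik, hnk⟩ := max_lt_iff.1 (hm.trans_le hk)
    refine mem_iUnion₂.2 ⟨k, hnk.le, hlead.of_inl_mul i, ?_⟩
    simpa using ⟨hik, hlt⟩
  · rintro _ ⟨i, rfl⟩ n
    obtain ⟨m, hm⟩ := exists_gt (max i n)
    refine ⟨m, fun u hu => ?_⟩
    obtain ⟨k, hk, hlead, hlt⟩ := mem_iUnion₂.1 hu
    obtain ⟨hik, hnk⟩ := max_lt_iff.1 (hm.trans_le hk)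
    refine mem_iUnion₂.2 ⟨k, hnk.le, hlead.mul_of_inl i, ?_⟩
    simpa [or_imp, forall_and] using ⟨hlt, hik⟩
  · intro u hu v hv
    obtain ⟨k, hk, hu, hku⟩ := mem_iUnion₂.1 hu
    obtain ⟨l, -, hv, hlv⟩ := mem_iUnion₂.1 hv
    refine mem_iUnion₂.2 ⟨max k l, le_max_of_le_left hk, hu.mul hv, fun i hi => ?_⟩
    rw [map_mul, FreeMonoid.mem_mul] at hi
    exact hi.elim (fun h => lt_max_of_lt_left (hku i h)) fun h => lt_max_of_lt_right (hlv i h)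

instance neBot_boundedWords {I : Type*} [LinearOrder I] [Nonempty I] :
    (⨅ n : I, 𝓟 (⋃ k ≥ n, boundedWords k)).NeBot :=
  iInf_neBot_of_directed'
    (monotone_principal.comp_antitone antitone_iUnion_boundedWords).directed_ge fun n =>
      principal_neBot_iff.2 ⟨.of (.inr n), mem_iUnion₂.2 ⟨n, le_rfl, isLeading_of_inr n, by simp⟩⟩

theorem mk_boundedWords_lt {I : Type u} [LinearOrder I] [WellFoundedLT I] (hI : ℵ₀ < #I)
    (hord : ord #I = Ordinal.type fun i j : I => i < j) (k : I) : #(boundedWords k) < #I := by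
  let A : Set (I ⊕ I) := Sum.inl '' Iio k ∪ Sum.inr '' Iic k
  have hIio : #(Iio k) < #I := mk_Iio_lt k hord
  have hIic : #(Iic k) < #I := by
    rw [← Iio_insert]
    exact mk_insert_le.trans_lt (add_lt_of_lt hI.le hIio (one_lt_aleph0.trans hI))
  have hA : #A < #I := (mk_union_le _ _).trans_lt <|
    add_lt_of_lt hI.le (mk_image_le.trans_lt hIio) (mk_image_le.trans_lt hIic)
  have hsub : boundedWords k ⊆ range (FreeSemigroup.map ((↑) : A → I ⊕ I)) := fun u hu =>
    mem_range_freeSemigroup_map_iff.2 fun c hc => by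
      rw [Subtype.range_coe]
      cases c with
      | inl i => exact .inl ⟨i, hu.2 i hc, rfl⟩
      | inr j => exact .inr ⟨j, hu.1.2 j hc, rfl⟩
  exact (mk_le_mk_of_subset hsub).trans_lt <| mk_range_le.trans_lt <|
    (mk_freeSemigroup_le_max A).trans_lt (max_lt hI hA)

theorem exists_isPolyCover_of_forall_not_isVanishing {M : Type u} [Semigroup M] (hM : ℵ₀ < #M)
    (hvan : ∀ F : Filter M, ¬ IsVanishing F) :
    ∃ σ : Set (PolyWord M × M), #σ < #M ∧ IsPolyCover id σ := by
  by_contra! hcover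
  obtain ⟨_, _, hord⟩ := exists_ord_eq_type_lt M
  have : Infinite M := aleph0_le_mk_iff.1 hM.le
  have : NoMaxOrder M :=
    Ordinal.isSuccPrelimit_type_lt_iff.1 (hord ▸ (isSuccLimit_ord hM.le).isSuccPrelimit)
  obtain ⟨x, hx⟩ := exists_forall_lift_notMem (V := boundedWords) (bad := Iio) (id : M → M)
    (fun k u hu => hu.1) fun k p hp => by
      let equation (q : boundedWords k × Iio k) : PolyWord M × M := (p q.1, q.2)
      have hlt : #(range equation) < #M := mk_range_le.trans_lt <| by
        rw [mk_prod, Cardinal.lift_id, Cardinal.lift_id]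
        exact mul_lt_of_lt hM.le (mk_boundedWords_lt hM hord k) (mk_Iio_lt k hord)
      have hnot := hcover _ hlt
      simp only [IsPolyCover, forall_mem_range, exists_range_iff, not_and, not_forall,
        not_exists] at hnot
      obtain ⟨y, hy⟩ := hnot fun q => hp q.1
      exact ⟨y, fun u hu => hy (u, ⟨_, hu⟩) rfl⟩
  let g : FreeSemigroup (M ⊕ M) →ₙ* M := FreeSemigroup.lift (Sum.elim id x)
  refine hvan ((⨅ n : M, 𝓟 (⋃ k ≥ n, boundedWords k)).map g) ⟨inferInstance, ?_, fun b => ?_⟩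
  · convert isAbsorbing_boundedWords.map g
    rw [← range_comp]
    exact range_id.symm
  · obtain ⟨n, hn⟩ := exists_gt b
    refine mem_iInf_of_mem n fun u hu hb => ?_
    obtain ⟨k, hk, hu⟩ := mem_iUnion₂.1 hu
    exact hx k u hu ((mem_singleton_iff.1 hb).trans_lt (hn.trans_le hk))

end SmallCover

section Nonexpansive

/-- The translations of `M` do not increase distances: the metric of `M` is subinvariant. -/
class NonexpansiveMul (M : Type*) [Mul M] [PseudoMetricSpace M] : Prop where
  dist_mul_left_le : ∀ a x y : M, dist (a * x) (a * y) ≤ dist x y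
  dist_mul_right_le : ∀ a x y : M, dist (x * a) (y * a) ≤ dist x y

theorem IsSubinvariantDist.nonexpansiveMul {X : Type u} [Semigroup X] [MetricSpace X]
    (h : IsSubinvariantDist X) : NonexpansiveMul X where
  dist_mul_left_le a x y := h a 1 x y (a * x) (a * y) (by simp) (by simp)
  dist_mul_right_le a x y := h 1 a x y (x * a) (y * a) (by simp) (by simp)

variable {M : Type*} [Semigroup M] [PseudoMetricSpace M] [NonexpansiveMul M]

theorem dist_mul_mul_le_add (a b c d : M) : dist (a * b) (c * d) ≤ dist a c + dist b d :=
  calc dist (a * b) (c * d) ≤ dist (a * b) (c * b) + dist (c * b) (c * d) := dist_triangle _ _ _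
    _ ≤ dist a c + dist b d :=
      add_le_add (NonexpansiveMul.dist_mul_right_le _ _ _) (NonexpansiveMul.dist_mul_left_le _ _ _)

instance : ContinuousMul M where
  continuous_mul := by
    have : LipschitzWith 2 fun p : M × M => p.1 * p.2 := LipschitzWith.of_dist_le_mul fun p q => by
      have h₁ : dist p.1 q.1 ≤ dist p q := le_max_left _ _
      have h₂ : dist p.2 q.2 ≤ dist p q := le_max_right _ _
      have := dist_mul_mul_le_add p.1 p.2 q.1 q.2
      norm_num
      linarith
    exact this.continuous

end Nonexpansive

section ThickenedFilter

open Metric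

variable {M : Type*} [PseudoMetricSpace M] {F : Filter M} {T : Set M}

/-- The filter generated by the `ε`-thickenings, for `ε > 0`, of the sets of `F`. -/
def thickenedFilter (F : Filter M) : Filter M where
  sets := {s | ∃ ε > 0, ∀ᶠ u in F, ball u ε ⊆ s}
  univ_sets := ⟨1, one_pos, .of_forall fun _ => subset_univ _⟩
  sets_of_superset := fun ⟨ε, hε, h⟩ hst => ⟨ε, hε, h.mono fun _ hu => hu.trans hst⟩
  inter_sets := fun ⟨ε, hε, h⟩ ⟨δ, hδ, h'⟩ => ⟨min ε δ, lt_min hε hδ, (h.and h').mono fun _ hu =>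
    subset_inter ((ball_subset_ball (min_le_left ε δ)).trans hu.1)
      ((ball_subset_ball (min_le_right ε δ)).trans hu.2)⟩

theorem le_thickenedFilter (F : Filter M) : F ≤ thickenedFilter F := fun _ ⟨_, hε, h⟩ =>
  h.mono fun _ hu => hu (mem_ball_self hε)

theorem compl_singleton_mem_thickenedFilter {V : Set M} {b : M} (hV : IsOpen V) (hb : b ∈ V)
    (hF : Vᶜ ∈ F) : {b}ᶜ ∈ thickenedFilter F := by
  obtain ⟨ε, hε, hball⟩ := isOpen_iff.1 hV b hb
  refine ⟨ε, hε, mem_of_superset hF fun u hu y hy hyb => hu (hball ?_)⟩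
  rwa [mem_singleton_iff.1 hyb, mem_ball_comm] at hy

theorem IsAbsorbing.thickenedFilter [Semigroup M] [NonexpansiveMul M] (hF : IsAbsorbing F T)
    (hT : Dense T) : IsAbsorbing (thickenedFilter F) univ where
  mul_left a _ := by
    rintro s ⟨ε, hε, h⟩
    obtain ⟨t, ht, hat⟩ := hT.exists_dist_lt a (half_pos hε)
    refine ⟨ε / 2, half_pos hε, ((hF.mul_left t ht).eventually h).mono fun u hu y hy => hu ?_⟩
    exact mem_ball.2 (by linarith [dist_mul_mul_le_add a y t u, mem_ball.1 hy])
  mul_right a _ := by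
    rintro s ⟨ε, hε, h⟩
    obtain ⟨t, ht, hat⟩ := hT.exists_dist_lt a (half_pos hε)
    refine ⟨ε / 2, half_pos hε, ((hF.mul_right t ht).eventually h).mono fun u hu y hy => hu ?_⟩
    exact mem_ball.2 (by linarith [dist_mul_mul_le_add y a u t, mem_ball.1 hy])
  mul := by
    rintro s ⟨ε, hε, h⟩
    obtain ⟨U, hU, hUs⟩ := mem_prod_same_iff.1 (hF.mul.eventually h)
    have hmem : {y | ∃ u ∈ U, y ∈ ball u (ε / 2)} ∈ _root_.thickenedFilter F :=
      ⟨ε / 2, half_pos hε, mem_of_superset hU fun u hu y hy => ⟨u, hu, hy⟩⟩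
    refine mem_prod_same_iff.2 ⟨_, hmem, ?_⟩
    rintro ⟨x, y⟩ ⟨⟨u, hu, hxu⟩, ⟨v, hv, hyv⟩⟩
    refine hUs (mk_mem_prod hu hv) (mem_ball.2 ?_)
    linarith [dist_mul_mul_le_add x y u v, mem_ball.1 hxu, mem_ball.1 hyv]

end ThickenedFilter

section DominatedWords

/-- The weight of a word, each letter `inl i` weighing `2 ^ i` and each letter `inr j` weighing
`1`. -/
def weight (u : FreeSemigroup (ℕ ⊕ ℕ)) : ℕ :=
  ((toFreeMonoid u).toList.map (Sum.elim (2 ^ ·) 1)).sum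

@[simp]
theorem weight_of (c : ℕ ⊕ ℕ) : weight (.of c) = Sum.elim (2 ^ ·) 1 c := by
  simp [weight]

@[simp]
theorem weight_mul (u v : FreeSemigroup (ℕ ⊕ ℕ)) : weight (u * v) = weight u + weight v := by
  simp [weight]

theorem weight_letter_le {u : FreeSemigroup (ℕ ⊕ ℕ)} {c : ℕ ⊕ ℕ} (hc : c ∈ toFreeMonoid u) :
    weight (.of c) ≤ weight u := by
  rw [weight_of]
  exact List.single_le_sum (fun _ _ => Nat.zero_le _) _ (List.mem_map_of_mem hc)

theorem length_le_weight (u : FreeSemigroup (ℕ ⊕ ℕ)) : (toFreeMonoid u).length ≤ weight u := by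
  have := List.card_nsmul_le_sum ((toFreeMonoid u).toList.map (Sum.elim (2 ^ ·) 1)) 1 <| by
    simp only [List.mem_map, forall_exists_index, and_imp]
    rintro _ (i | j) - rfl
    exacts [Nat.one_le_two_pow, le_rfl]
  simpa [weight, FreeMonoid.length] using this

theorem weight_pos (u : FreeSemigroup (ℕ ⊕ ℕ)) : 1 ≤ weight u :=
  (Nat.one_le_iff_ne_zero.2 (FreeMonoid.length_eq_zero.not.2 u.toFreeMonoid_ne_one)).trans
    (length_le_weight u)

/-- The words of weight at most `2 ^ (k - n)`, where `inr k` is the leading letter. -/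
def dominatedWords (n : ℕ) : Set (FreeSemigroup (ℕ ⊕ ℕ)) :=
  {u | ∃ k, IsLeading k u ∧ 2 ^ n * weight u ≤ 2 ^ k}

theorem le_of_two_pow_mul_weight_le {n k : ℕ} {u : FreeSemigroup (ℕ ⊕ ℕ)}
    (h : 2 ^ n * weight u ≤ 2 ^ k) : n ≤ k :=
  (Nat.pow_le_pow_iff_right one_lt_two).1 ((Nat.le_mul_of_pos_right _ (weight_pos u)).trans h)

theorem antitone_dominatedWords : Antitone dominatedWords := fun _ _ hmn _ ⟨k, hk, h⟩ =>
  ⟨k, hk, (Nat.mul_le_mul_right _ (Nat.pow_le_pow_right two_pos hmn)).trans h⟩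

theorem isAbsorbing_dominatedWords :
    IsAbsorbing (⨅ n, 𝓟 (dominatedWords n)) (range fun i => .of (.inl i)) := by
  have weight_add_le (n i : ℕ) (u : FreeSemigroup (ℕ ⊕ ℕ)) :
      2 ^ n * (2 ^ i + weight u) ≤ 2 ^ (n + i + 1) * weight u := by
    have h : 2 ^ i + weight u ≤ 2 ^ i * weight u + 2 ^ i * weight u :=
      add_le_add (Nat.le_mul_of_pos_right _ (weight_pos u))
        (Nat.le_mul_of_pos_left _ (Nat.two_pow_pos i))
    calc 2 ^ n * (2 ^ i + weight u) ≤ 2 ^ n * (2 ^ i * weight u + 2 ^ i * weight u) :=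
          Nat.mul_le_mul_left _ h
      _ = 2 ^ (n + i + 1) * weight u := by ring
  refine isAbsorbing_iInf_principal antitone_dominatedWords ?_ ?_ fun n => ⟨n + 1, ?_⟩
  · rintro _ ⟨i, rfl⟩ n
    refine ⟨n + i + 1, fun u ⟨k, hk, hu⟩ => ⟨k, hk.of_inl_mul i, ?_⟩⟩
    simpa using (weight_add_le n i u).trans hu
  · rintro _ ⟨i, rfl⟩ n
    refine ⟨n + i + 1, fun u ⟨k, hk, hu⟩ => ⟨k, hk.mul_of_inl i, ?_⟩⟩
    simpa [add_comm] using (weight_add_le n i u).trans hu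
  · rintro u ⟨k, hk, hu⟩ v ⟨l, hl, hv⟩
    refine ⟨max k l, hk.mul hl, ?_⟩
    have hk' : 2 ^ k ≤ 2 ^ max k l := Nat.pow_le_pow_right two_pos (le_max_left k l)
    have hl' : 2 ^ l ≤ 2 ^ max k l := Nat.pow_le_pow_right two_pos (le_max_right k l)
    rw [weight_mul]
    rw [pow_succ] at hu hv
    linarith

instance neBot_dominatedWords : (⨅ n, 𝓟 (dominatedWords n)).NeBot :=
  iInf_neBot_of_directed' (monotone_principal.comp_antitone antitone_dominatedWords).directed_ge
    fun n => principal_neBot_iff.2 ⟨.of (.inr n), n, isLeading_of_inr n, by simp⟩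

theorem finite_setOf_isLeading_weight_le (k N : ℕ) :
    {u | IsLeading k u ∧ weight u ≤ N}.Finite := by
  let A : Set (ℕ ⊕ ℕ) := Sum.inl '' Iic N ∪ Sum.inr '' Iic k
  have : Finite A := (((finite_Iic N).image _).union ((finite_Iic k).image _)).to_subtype
  refine .of_finite_image (((List.finite_length_le A N).image (List.map (↑))).subset ?_)
    FreeSemigroup.toFreeMonoid_injective.injOn
  rintro _ ⟨u, ⟨hlead, hweight⟩, rfl⟩
  obtain ⟨l, hl⟩ : toFreeMonoid u ∈ range (List.map ((↑) : A → ℕ ⊕ ℕ)) := by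
    rw [range_list_map_coe]
    rintro (i | j) hc
    · exact .inl ⟨i, Nat.lt_two_pow_self.le.trans ((weight_letter_le hc).trans hweight), rfl⟩
    · exact .inr ⟨j, hlead.2 j hc, rfl⟩
  refine ⟨l, ?_, hl⟩
  calc l.length = (toFreeMonoid u).length := by rw [← List.length_map, hl]; rfl
    _ ≤ N := (length_le_weight u).trans hweight

theorem exists_isAbsorbing_of_forall_exists_ev_notMem {M : Type*} [Semigroup M] [Nonempty M]
    (a : ℕ → M) {B : ℕ → Set M}
    (h : ∀ k (s : Set (PolyWord M)), s.Finite → (∀ w ∈ s, HasVar w) →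
      ∃ y, ∀ w ∈ s, ∀ j ≤ k, ev id w y ∉ B j) :
    ∃ F : Filter M, F.NeBot ∧ IsAbsorbing F (range a) ∧ ∀ j, (B j)ᶜ ∈ F := by
  obtain ⟨x, hx⟩ := exists_forall_lift_notMem (V := fun k => {u | IsLeading k u ∧ weight u ≤ 2 ^ k})
    (bad := fun k => ⋃ j ≤ k, B j) a (fun k u hu => hu.1) fun k p hp => by
      have := (finite_setOf_isLeading_weight_le k (2 ^ k)).to_subtype
      obtain ⟨y, hy⟩ := h k (range p) (finite_range p) (forall_mem_range.2 hp)
      exact ⟨y, fun u => by simpa using hy (p u) ⟨u, rfl⟩⟩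
  let g : FreeSemigroup (ℕ ⊕ ℕ) →ₙ* M := FreeSemigroup.lift (Sum.elim a x)
  refine ⟨(⨅ n, 𝓟 (dominatedWords n)).map g, inferInstance, ?_, fun j => ?_⟩
  · convert isAbsorbing_dominatedWords.map g
    rw [← range_comp]
    rfl
  · refine mem_iInf_of_mem j fun u ⟨k, hk, hu⟩ hB => hx k u ⟨hk, ?_⟩ ?_
    · exact (Nat.le_mul_of_pos_left _ (Nat.two_pow_pos j)).trans hu
    · exact mem_iUnion₂.2 ⟨j, le_of_two_pow_mul_weight_le hu, hB⟩

end DominatedWords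

section Category

theorem floor_two_pow_mul_eq_div (s : ℝ) {i m : ℕ} (hi : i ≤ m) :
    ⌊2 ^ i * s⌋ = ⌊2 ^ m * s⌋ / 2 ^ (m - i) := by
  have h : 2 ^ i * s = 2 ^ m * s / (2 ^ (m - i) : ℕ) := by
    rw [eq_div_iff (by positivity), mul_right_comm]
    push_cast
    rw [← pow_add, Nat.add_sub_cancel' hi]
  rw [h, Int.floor_div_natCast]
  norm_cast

/-- The places at which the binary expansion of `t` has the digit `1`. -/
def binaryDigits (t : ℝ) : Set ℕ := {n | Odd ⌊2 ^ n * t⌋}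

theorem binaryDigits_of_floor_eq {s t : ℝ} {m n : ℕ} (hnm : n < m)
    (h : ⌊2 ^ m * s⌋ = ⌊2 ^ n * t⌋ * 2 ^ (m - n) + 1) :
    ⌊2 ^ n * s⌋ = ⌊2 ^ n * t⌋ ∧
      ∀ i ≤ m, (i ∈ binaryDigits s ↔ (i ≤ n ∧ i ∈ binaryDigits t) ∨ i = m) := by
  have hfloor {i : ℕ} (hni : n ≤ i) (him : i < m) :
      ⌊2 ^ i * s⌋ = ⌊2 ^ n * t⌋ * 2 ^ (i - n) := by
    have hpow : (2 : ℤ) ^ (m - n) = 2 ^ (i - n) * 2 ^ (m - i) := by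
      rw [← pow_add]
      congr 1
      omega
    rw [floor_two_pow_mul_eq_div s him.le, h, hpow, ← mul_assoc, add_comm,
      Int.add_mul_ediv_right _ _ (by positivity),
      Int.ediv_eq_zero_of_lt one_pos.le (one_lt_pow₀ _root_.one_lt_two (by omega : m - i ≠ 0)),
      zero_add]
  have hn : ⌊2 ^ n * s⌋ = ⌊2 ^ n * t⌋ := by simpa using hfloor le_rfl hnm
  refine ⟨hn, fun i him => ?_⟩
  rcases le_or_gt i n with hin | hni
  · have : ⌊2 ^ i * s⌋ = ⌊2 ^ i * t⌋ := by
      rw [floor_two_pow_mul_eq_div s hin, hn, ← floor_two_pow_mul_eq_div t hin]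
    simp [binaryDigits, this, hin, (hin.trans_lt hnm).ne]
  rcases him.lt_or_eq with him | rfl
  · have : ¬ Odd ⌊2 ^ i * s⌋ := by
      rw [hfloor hni.le him, Int.not_odd_iff_even]
      exact (Int.even_pow.2 ⟨even_two, by omega⟩).mul_left _
    simpa [binaryDigits, hni.not_ge, him.ne] using this
  · have : Odd ⌊2 ^ i * s⌋ := by
      rw [h]
      exact ((Int.even_pow.2 ⟨even_two, by omega⟩).mul_left _).add_one
    simpa [binaryDigits] using this

theorem exists_isOpen_binaryDigits_eq {V : Set ℝ} (hV : IsOpen V) {t : ℝ} (ht : t ∈ V) :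
    ∃ n, ∀ m > n, ∃ W ⊆ V, IsOpen W ∧ W.Nonempty ∧ ∀ s ∈ W, ∀ i ≤ m,
      (i ∈ binaryDigits s ↔ (i ≤ n ∧ i ∈ binaryDigits t) ∨ i = m) := by
  obtain ⟨ε, hε, hball⟩ := Metric.isOpen_iff.1 hV t ht
  obtain ⟨n, hn⟩ := exists_pow_lt_of_lt_one hε (one_half_lt_one : (1 / 2 : ℝ) < 1)
  refine ⟨n, fun m hm => ?_⟩
  let j : ℤ := ⌊2 ^ n * t⌋ * 2 ^ (m - n) + 1
  have hfloor {s : ℝ} (hs : s ∈ Ioo (j / 2 ^ m : ℝ) ((j + 1) / 2 ^ m)) : ⌊2 ^ m * s⌋ = j := by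
    rw [mem_Ioo, div_lt_iff₀' (by positivity), lt_div_iff₀' (by positivity)] at hs
    exact Int.floor_eq_iff.2 ⟨hs.1.le, hs.2⟩
  refine ⟨_, fun s hs => hball ?_, isOpen_Ioo, nonempty_Ioo.2 (by gcongr; linarith),
    fun s hs => (binaryDigits_of_floor_eq hm (hfloor hs)).2⟩
  have hlt := Int.abs_sub_lt_one_of_floor_eq_floor (binaryDigits_of_floor_eq hm (hfloor hs)).1
  rw [← mul_sub, abs_mul, abs_of_pos (by positivity), ← lt_div_iff₀' (by positivity)] at hlt
  rw [Metric.mem_ball, Real.dist_eq]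
  exact hlt.trans (by simpa using hn)

section DescentPath

variable {P : Type*} [Preorder P]

open scoped Classical in
/-- The path descending from `p` which, at the times `n ∈ d`, moves to `q n` whenever this is
below the current position. -/
noncomputable def descentPath (q : ℕ → P) (p : P) (d : Set ℕ) : ℕ → P
  | 0 => p
  | n + 1 => if n ∈ d ∧ q n ≤ descentPath q p d n then q n else descentPath q p d n

variable {q : ℕ → P} {p : P} {d d' : Set ℕ} {m n : ℕ}

theorem antitone_descentPath : Antitone (descentPath q p d) := antitone_nat_of_succ_le fun n => by
  rw [descentPath]
  split_ifs with h
  exacts [h.2, le_rfl]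

theorem descentPath_congr (h : ∀ i < n, (i ∈ d ↔ i ∈ d')) :
    descentPath q p d n = descentPath q p d' n := by
  induction n with
  | zero => rfl
  | succ n ih => rw [descentPath, descentPath, ih fun i hi => h i (by omega), h n (by omega)]

theorem descentPath_eq_of_forall_notMem (hmn : m ≤ n) (h : ∀ i, m ≤ i → i < n → i ∉ d) :
    descentPath q p d n = descentPath q p d m := by
  induction n, hmn using Nat.le_induction with
  | base => rfl
  | succ n hmn ih =>
    rw [descentPath, if_neg fun hn => h n hmn n.lt_succ_self hn.1,
      ih fun i hi hin => h i hi (by omega)]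

theorem isNowhereDense_setOf_descentPath_notMem (hq : ∀ r n, ∃ m ≥ n, q m = r) {D : Set P}
    (hD : IsCoinitial D) : IsNowhereDense {t | ∀ n, descentPath q p (binaryDigits t) n ∉ D} := by
  refine eq_empty_of_forall_notMem fun t ht => ?_
  obtain ⟨n, hn⟩ := exists_isOpen_binaryDigits_eq isOpen_interior ht
  obtain ⟨r, hr, hle⟩ := hD (descentPath q p (binaryDigits t) (n + 1))
  obtain ⟨m, hm, rfl⟩ := hq r (n + 1)
  obtain ⟨W, hWV, hW, hWne, hdigits⟩ := hn m hm
  obtain ⟨s, hs, hsW⟩ : ({t | ∀ n, descentPath q p (binaryDigits t) n ∉ D} ∩ W).Nonempty := by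
    obtain ⟨s, hs⟩ := hWne
    exact (closure_inter_open_nonempty_iff hW).1 ⟨s, interior_subset (hWV hs), hs⟩
  have hpath : descentPath q p (binaryDigits s) m = descentPath q p (binaryDigits t) (n + 1) := by
    rw [descentPath_eq_of_forall_notMem hm fun i hni him => by
      rw [hdigits s hsW i him.le]
      omega]
    exact descentPath_congr fun i hi => by
      rw [hdigits s hsW i (by omega)]
      simp only [Nat.lt_succ_iff.1 hi, true_and, or_iff_left_iff_imp]
      omega
  refine hs (m + 1) ?_
  rwa [descentPath, if_pos ⟨(hdigits s hsW m le_rfl).2 (.inr rfl), hpath ▸ hle⟩]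

end DescentPath

theorem aleph0_lt_covMeager : ℵ₀ < covMeager := by
  obtain ⟨C, hC, hcover, hcard⟩ : covMeager ∈ {κ | ∃ C : Set (Set ℝ), (∀ s ∈ C, IsMeagre s) ∧
      ⋃₀ C = univ ∧ #C = κ} := csInf_mem
    ⟨_, range singleton, forall_mem_range.2 fun t => (isClosed_singleton.isNowhereDense_iff.2
      (interior_singleton t)).isMeagre, sUnion_range _ ▸ Set.iUnion_of_singleton ℝ, rfl⟩
  rw [← hcard, ← not_le, le_aleph0_iff_set_countable]
  intro hcount
  refine not_isMeagre_of_isOpen isOpen_univ (univ_nonempty (α := ℝ)) ?_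
  rw [← hcover, sUnion_eq_biUnion]
  exact isMeagre_biUnion hcount hC

/-- `MA(countable)` holds below `cov(M)`. -/
theorem exists_antitone_forall_exists_mem {P : Type*} [Preorder P] [Countable P] [Nonempty P]
    {ι : Type v} (hι : #ι < lift.{v} covMeager) {D : ι → Set P} (hD : ∀ i, IsCoinitial (D i)) :
    ∃ p : ℕ → P, Antitone p ∧ ∀ i, ∃ n, p n ∈ D i := by
  obtain ⟨e, he⟩ := exists_surjective_nat P
  have hq (r : P) (n : ℕ) : ∃ m ≥ n, e m.unpair.1 = r := by
    obtain ⟨k, rfl⟩ := he r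
    exact ⟨Nat.pair k n, Nat.right_le_pair _ _, by simp⟩
  let path (t : ℝ) : ℕ → P := descentPath (fun m => e m.unpair.1) (e 0) (binaryDigits t)
  obtain ⟨t, ht⟩ : ∃ t, ∀ i, ∃ n, path t n ∈ D i := by
    by_contra! hcover
    let A (i : ι) : Set ℝ := {t | ∀ n, path t n ∉ D i}
    have hle : covMeager ≤ #(range A) := csInf_le' ⟨range A, forall_mem_range.2 fun i =>
      (isNowhereDense_setOf_descentPath_notMem hq (hD i)).isMeagre,
      eq_univ_of_forall fun t => by simpa [A] using hcover t, rfl⟩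
    have hrange : lift.{v} #(range A) ≤ lift.{0} #ι := mk_range_le_lift
    rw [lift_uzero] at hrange
    exact ((lift_le.2 hle).trans hrange).not_gt hι
  exact ⟨path t, antitone_descentPath, ht⟩

theorem nonempty_iInter_closure_of_antitone {Z : Type*} [PseudoMetricSpace Z] [CompleteSpace Z]
    {s : ℕ → Set Z} (hs : Antitone s) (hne : ∀ n, (s n).Nonempty)
    (hsmall : ∀ ε > 0, ∃ n z, s n ⊆ Metric.ball z ε) : (⋂ n, closure (s n)).Nonempty := by
  let F : Filter Z := ⨅ n, 𝓟 (s n)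
  have hcauchy : Cauchy F := by
    refine Metric.cauchy_iff.2
      ⟨iInf_neBot_of_directed' (monotone_principal.comp_antitone hs).directed_ge
        fun n => principal_neBot_iff.2 (hne n), fun ε hε => ?_⟩
    obtain ⟨n, z, hz⟩ := hsmall (ε / 2) (half_pos hε)
    refine ⟨s n, mem_iInf_of_mem n (mem_principal_self _), fun x hx y hy => ?_⟩
    linarith [dist_triangle_right x y z, Metric.mem_ball.1 (hz hx), Metric.mem_ball.1 (hz hy)]
  obtain ⟨z, hz⟩ := CompleteSpace.complete hcauchy
  exact ⟨z, mem_iInter.2 fun n => mem_closure_iff_clusterPt.2 <| hcauchy.1.mono <|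
    le_inf hz (iInf_le _ n)⟩

theorem exists_mem_countableBasis_closure_subset {Z : Type*} [TopologicalSpace Z]
    [SecondCountableTopology Z] [RegularSpace Z] {s O : Set Z}
    (hs : s ∈ TopologicalSpace.countableBasis Z) (hO : IsOpen O) (h : (s ∩ O).Nonempty) :
    ∃ r ∈ TopologicalSpace.countableBasis Z, closure r ⊆ O ∧ r ⊆ s := by
  obtain ⟨z, hz⟩ := h
  have hbasis := TopologicalSpace.isBasis_countableBasis Z
  obtain ⟨r, hr, -, hsub⟩ :=
    hbasis.exists_closure_subset (((hbasis.isOpen hs).inter hO).mem_nhds hz)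
  exact ⟨r, hr, hsub.trans inter_subset_right, subset_closure.trans (hsub.trans inter_subset_left)⟩

theorem exists_interior_nonempty_of_forall_exists_mem {Z : Type*} [TopologicalSpace Z]
    [PolishSpace Z] [Nonempty Z] {ι : Type v} (hι : #ι < lift.{v} covMeager) {C : ι → Set Z}
    (hC : ∀ i, IsClosed (C i)) (hcover : ∀ z, ∃ i, z ∈ C i) : ∃ i, (interior (C i)).Nonempty := by
  by_contra! hint
  let _ := TopologicalSpace.upgradeIsCompletelyMetrizable Z
  let P := TopologicalSpace.countableBasis Z
  have hbasis := TopologicalSpace.isBasis_countableBasis Z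
  have hne (r : P) : r.1.Nonempty := TopologicalSpace.nonempty_of_mem_countableBasis r.2
  have : Countable P := (TopologicalSpace.countable_countableBasis Z).to_subtype
  have : Nonempty P :=
    let ⟨r, hr, _⟩ := hbasis.exists_nonempty_subset univ_nonempty isOpen_univ
    ⟨⟨r, hr⟩⟩
  let D : ι ⊕ ℕ → Set P := Sum.elim (fun i => {r | closure r.1 ⊆ (C i)ᶜ})
    fun n => {r | ∃ z, r.1 ⊆ Metric.ball z (1 / (n + 1))}
  have hD : ∀ i, IsCoinitial (D i) := by
    rintro (i | n) r
    · obtain ⟨r', hr', hsub, hle⟩ := exists_mem_countableBasis_closure_subset r.2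
        (hC i).isOpen_compl <| inter_compl_nonempty_iff.2 fun hsub => (hne r).ne_empty <|
          subset_empty_iff.1 (hint i ▸ interior_maximal hsub (hbasis.isOpen r.2))
      exact ⟨⟨r', hr'⟩, hsub, hle⟩
    · obtain ⟨z, hz⟩ := hne r
      obtain ⟨r', hr', hsub, hle⟩ := exists_mem_countableBasis_closure_subset r.2
        Metric.isOpen_ball ⟨z, hz, Metric.mem_ball_self Nat.one_div_pos_of_nat⟩
      exact ⟨⟨r', hr'⟩, ⟨z, subset_closure.trans hsub⟩, hle⟩
  have hcard : #(ι ⊕ ℕ) < lift.{v} covMeager := by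
    have hcov : ℵ₀ < lift.{v} covMeager := aleph0_lt_lift.2 aleph0_lt_covMeager
    rw [mk_sum, lift_uzero, mk_nat, lift_aleph0]
    exact add_lt_of_lt hcov.le hι hcov
  obtain ⟨p, hp, hpD⟩ := exists_antitone_forall_exists_mem hcard hD
  obtain ⟨z, hz⟩ := nonempty_iInter_closure_of_antitone (s := fun n => (p n).1) hp
    (fun n => hne (p n)) fun ε hε => by
      obtain ⟨k, hk⟩ := exists_nat_one_div_lt hε
      obtain ⟨n, z, hz⟩ := hpD (.inr k)
      exact ⟨n, z, hz.trans (Metric.ball_subset_ball hk.le)⟩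
  obtain ⟨i, hi⟩ := hcover z
  obtain ⟨n, hn⟩ := hpD (.inl i)
  exact hn (mem_iInter.1 hz n) hi

theorem mk_le_continuum_of_secondCountableTopology (M : Type u) [TopologicalSpace M] [T0Space M]
    [SecondCountableTopology M] : #M ≤ continuum.{u} := by
  let B := TopologicalSpace.countableBasis M
  have hinj : Function.Injective fun x : M => {b : B | x ∈ b.1} := fun x y hxy =>
    ((TopologicalSpace.isBasis_countableBasis M).inseparable_iff.2 fun s hs =>
      Set.ext_iff.1 hxy ⟨s, hs⟩).eq
  calc #M ≤ #(Set B) := mk_le_of_injective hinj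
    _ ≤ 2 ^ ℵ₀ := by
      rw [mk_set]
      exact power_le_power_left two_ne_zero (TopologicalSpace.countable_countableBasis M).le_aleph0
    _ = continuum := two_power_aleph0

end Category

section Ideals

variable {M : Type u} [Semigroup M]

/-- A nonempty two-sided ideal. -/
structure IsMulIdeal (C : Set M) : Prop where
  nonempty : C.Nonempty
  mul_left : ∀ a, ∀ c ∈ C, a * c ∈ C
  mul_right : ∀ a, ∀ c ∈ C, c * a ∈ C

theorem IsMulIdeal.ev_mem {C : Set M} (hC : IsMulIdeal C) {w : PolyWord M} (hw : HasVar w) {x : M}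
    (hx : x ∈ C) : ev id w x ∈ C := by
  induction w using induction with
  | var => exact hx
  | const c => exact absurd hw (not_hasVar_const c)
  | mul v w hv hw' =>
    rw [ev_mul]
    exact (hasVar_mul.1 hw).elim (fun h => hC.mul_right _ _ (hv h))
      fun h => hC.mul_left _ _ (hw' h)

theorem isMulIdeal_univ [Nonempty M] : IsMulIdeal (univ : Set M) :=
  ⟨univ_nonempty, fun _ _ _ => trivial, fun _ _ _ => trivial⟩

theorem IsMulIdeal.inter {C D : Set M} (hC : IsMulIdeal C) (hD : IsMulIdeal D) :
    IsMulIdeal (C ∩ D) where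
  nonempty :=
    let ⟨c, hc⟩ := hC.nonempty
    let ⟨d, hd⟩ := hD.nonempty
    ⟨c * d, hC.mul_right _ _ hc, hD.mul_left _ _ hd⟩
  mul_left a c hc := ⟨hC.mul_left a c hc.1, hD.mul_left a c hc.2⟩
  mul_right a c hc := ⟨hC.mul_right a c hc.1, hD.mul_right a c hc.2⟩

theorem isMulIdeal_sInter [Nonempty M] {S : Set (Set M)} (hS : S.Finite)
    (h : ∀ C ∈ S, IsMulIdeal C) : IsMulIdeal (⋂₀ S) := by
  induction S, hS using Set.Finite.induction_on with
  | empty => rw [sInter_empty]; exact isMulIdeal_univ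
  | insert _ _ ih =>
    rw [forall_mem_insert] at h
    rw [sInter_insert]
    exact h.1.inter (ih h.2)

/-- Some polynomial is constant on the intersection of `B` with some ideal. -/
def IsIdeallyConstant (B : Set M) : Prop :=
  ∃ C, IsMulIdeal C ∧ ∃ (f : PolyWord M) (b : M), HasVar f ∧ ∀ y ∈ C ∩ B, ev id f y = b

theorem exists_forall_ev_notMem_of_not_isWordBounded [Nonempty M] (hM : ¬ IsWordBounded M)
    {ι : Type*} [Finite ι] {B : ι → Set M} (hB : ∀ i, IsIdeallyConstant (B i))
    {s : Set (PolyWord M)} (hs : s.Finite) (hvar : ∀ w ∈ s, HasVar w) :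
    ∃ y, ∀ w ∈ s, ∀ i, ev id w y ∉ B i := by
  choose C hC f b hf hb using hB
  obtain ⟨z, hz⟩ := (isMulIdeal_sInter (finite_range C) (forall_mem_range.2 hC)).nonempty
  by_contra! hcover
  let σ : Set (PolyWord M × M) :=
    (fun p : PolyWord M × ι => (subst (f p.2) (subst p.1 (const z * var)), b p.2)) '' s ×ˢ univ
  refine hM ⟨σ, (hs.prod finite_univ).image _, forall_mem_image.2 fun p hp =>
    (hf _).subst ((hvar _ hp.1).subst (by simp)), fun x => ?_⟩
  obtain ⟨w, hw, i, hi⟩ := hcover (z * x)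
  refine ⟨_, ⟨(w, i), ⟨hw, trivial⟩, rfl⟩, ?_⟩
  have hzx : z * x ∈ C i := (hC i).mul_right _ _ (mem_sInter.1 hz _ (mem_range_self i))
  simpa [ev_subst] using hb i _ ⟨(hC i).ev_mem (hvar w hw) hzx, hi⟩

theorem isMulIdeal_setOf_forall_ev_notMem {B : Set M}
    (h : {x | ∀ q, HasVar q → ev id q x ∉ B}.Nonempty) :
    IsMulIdeal {x | ∀ q, HasVar q → ev id q x ∉ B} where
  nonempty := h
  mul_left a c hc q hq := by
    have := hc (subst q (const a * var)) (hq.subst (by simp))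
    rwa [ev_subst, ev_mul] at this
  mul_right a c hc q hq := by
    have := hc (subst q (var * const a)) (hq.subst (by simp))
    rwa [ev_subst, ev_mul] at this

theorem isClosed_setOf_forall_ev_notMem [TopologicalSpace M] [ContinuousMul M] {B : Set M}
    (hB : IsOpen B) : IsClosed {x | ∀ q, HasVar q → ev id q x ∉ B} := by
  simp only [Set.ofPred_forall]
  exact isClosed_iInter fun q => isClosed_iInter fun _ =>
    (hB.preimage (continuous_ev_right id q)).isClosed_compl

theorem IsPolyCover.exists_ev_mem_isIdeallyConstant [TopologicalSpace M] [PolishSpace M]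
    [ContinuousMul M] {σ : Set (PolyWord M × M)} (hcover : IsPolyCover id σ)
    (hσ : #σ < lift.{u} covMeager) (x : M) :
    ∃ q, HasVar q ∧ ∃ V ∈ TopologicalSpace.countableBasis M, IsIdeallyConstant V ∧
      ev id q x ∈ V := by
  by_contra! hx
  have hbasis := TopologicalSpace.isBasis_countableBasis M
  let B : Set M := ⋃₀ {V ∈ TopologicalSpace.countableBasis M | IsIdeallyConstant V}
  let Z : Set M := {x | ∀ q, HasVar q → ev id q x ∉ B}
  have hideal : IsMulIdeal Z := isMulIdeal_setOf_forall_ev_notMem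
    ⟨x, fun q hq ⟨V, hV, hqx⟩ => hx q hq V hV.1 hV.2 hqx⟩
  have hclosed : IsClosed Z :=
    isClosed_setOf_forall_ev_notMem (isOpen_sUnion fun V hV => hbasis.isOpen hV.1)
  have := hclosed.polishSpace
  have := hideal.nonempty.to_subtype
  let C (p : σ) : Set Z := {z | ev id p.1.1 (z : M) = p.1.2}
  have hC (p : σ) : IsClosed (C p) := isClosed_eq
    ((continuous_ev_right id _).comp continuous_subtype_val) continuous_const
  obtain ⟨p, z, O, ⟨hOC, hO⟩, hzO⟩ := exists_interior_nonempty_of_forall_exists_mem hσ hC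
    fun z => let ⟨p, hp, h⟩ := hcover.2 z; ⟨⟨p, hp⟩, h⟩
  obtain ⟨U, hU, rfl⟩ := isOpen_induced_iff.1 hOC
  obtain ⟨V, hV, hzV, hVU⟩ := hbasis.exists_subset_of_mem_open hzO hU
  have hconst : IsIdeallyConstant V := ⟨Z, hideal, p.1.1, p.1.2, hcover.1 _ p.2,
    fun y hy => hO (show (⟨y, hy.1⟩ : Z) ∈ _ from hVU hy.2)⟩
  exact z.2 var hasVar_var ⟨V, ⟨hV, hconst⟩, hzV⟩

theorem exists_isPolyCover_mk_lt_continuum [TopologicalSpace M] [T0Space M]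
    [SecondCountableTopology M] (hvan : ∀ F : Filter M, ¬ IsVanishing F) :
    ∃ σ : Set (PolyWord M × M), #σ < continuum.{u} ∧ IsPolyCover id σ := by
  rcases (mk_le_continuum_of_secondCountableTopology M).lt_or_eq with hlt | heq
  · exact ⟨range fun b => (var, b), mk_range_le.trans_lt hlt,
      forall_mem_range.2 fun _ => hasVar_var, fun x => ⟨_, mem_range_self x, rfl⟩⟩
  · obtain ⟨σ, hσ, hcover⟩ :=
      exists_isPolyCover_of_forall_not_isVanishing (heq ▸ aleph0_lt_continuum) hvan
    exact ⟨σ, heq ▸ hσ, hcover⟩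

theorem isWordBounded_of_completeSpace [MetricSpace M] [CompleteSpace M]
    [TopologicalSpace.SeparableSpace M] [NonexpansiveMul M] (hcov : covMeager = continuum.{0})
    (hvan : ∀ F : Filter M, ¬ IsVanishing F) : IsWordBounded M := by
  rcases isEmpty_or_nonempty M with hempty | hne
  · exact ⟨∅, finite_empty, by simp, isEmptyElim⟩
  by_contra hM
  have : SecondCountableTopology M := UniformSpace.secondCountable_of_separable M
  obtain ⟨σ, hσ, hcover⟩ := exists_isPolyCover_mk_lt_continuum hvan
  have hreach := hcover.exists_ev_mem_isIdeallyConstant (by rwa [hcov, lift_continuum])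
  obtain ⟨B, hB⟩ : ∃ B : ℕ → Set M,
      {V | V ∈ TopologicalSpace.countableBasis M ∧ IsIdeallyConstant V} = range B :=
    ((TopologicalSpace.countable_countableBasis M).mono fun _ => And.left).exists_eq_range <|
      let ⟨_, _, V, hV, hconst, _⟩ := hreach hne.some
      ⟨V, hV, hconst⟩
  have hconst (j : ℕ) : IsIdeallyConstant (B j) := (hB.ge (mem_range_self j)).2
  obtain ⟨F, hF, habs, hFB⟩ := exists_isAbsorbing_of_forall_exists_ev_notMem (B := B)
    (TopologicalSpace.denseSeq M) fun k s hs hvar => by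
      simpa using exists_forall_ev_notMem_of_not_isWordBounded hM (ι := Iic k)
        (fun j => hconst j) hs hvar
  have habs' := habs.thickenedFilter (TopologicalSpace.denseRange_denseSeq M)
  refine hvan (thickenedFilter F) ⟨hF.mono (le_thickenedFilter F), habs', fun x => ?_⟩
  obtain ⟨q, hq, V, hV, hVconst, hqx⟩ := hreach x
  obtain ⟨j, rfl⟩ := hB.le ⟨hV, hVconst⟩
  have hopen := (TopologicalSpace.isBasis_countableBasis M).isOpen hV
  filter_upwards [habs'.tendsto_ev hq (compl_singleton_mem_thickenedFilter hopen hqx (hFB j))]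
    with y hy hyx
  exact hy (congrArg (ev id q) hyx)

end Ideals

section Compact

section OrbitMap

variable (S : Type*) {T X E : Type*} [TopologicalSpace S] [CompactSpace S] [TopologicalSpace X]
  [MetricSpace E]

/-- The map recording the values of `φ` along the orbits of `S`: the distance it induces is the
largest distance of the values of `φ` along two orbits. -/
def orbitMap [SMul S X] [ContinuousSMul S X] (φ : C(X, E)) : C(X, E × C(S, E)) :=
  φ.prodMk (φ.comp ⟨fun p : X × S => p.2 • p.1, by fun_prop⟩).curry

variable {S}

theorem dist_orbitMap_le [SMul S X] [ContinuousSMul S X] {φ : C(X, E)} {x y : X} {r : ℝ}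
    (h : dist (φ x) (φ y) ≤ r) (hsmul : ∀ s : S, dist (φ (s • x)) (φ (s • y)) ≤ r) :
    dist (orbitMap S φ x) (orbitMap S φ y) ≤ r :=
  max_le h ((ContinuousMap.dist_le (dist_nonneg.trans h)).2 hsmul)

theorem dist_le_dist_orbitMap [SMul S X] [ContinuousSMul S X] (φ : C(X, E)) (x y : X) :
    dist (φ x) (φ y) ≤ dist (orbitMap S φ x) (orbitMap S φ y) :=
  le_max_left _ _

theorem dist_smul_le_dist_orbitMap [SMul S X] [ContinuousSMul S X] (φ : C(X, E)) (s : S)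
    (x y : X) : dist (φ (s • x)) (φ (s • y)) ≤ dist (orbitMap S φ x) (orbitMap S φ y) :=
  (ContinuousMap.dist_apply_le_dist (f := (orbitMap S φ x).2) (g := (orbitMap S φ y).2) s).trans
    (le_max_right _ _)

theorem dist_orbitMap_smul_le [Mul S] [SMul S X] [IsScalarTower S S X] [ContinuousSMul S X]
    (φ : C(X, E)) (s : S) (x y : X) :
    dist (orbitMap S φ (s • x)) (orbitMap S φ (s • y)) ≤
      dist (orbitMap S φ x) (orbitMap S φ y) :=
  dist_orbitMap_le (dist_smul_le_dist_orbitMap φ s x y) fun t => by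
    simpa only [smul_assoc] using dist_smul_le_dist_orbitMap φ (t • s) x y

theorem dist_orbitMap_smul_comm_le [SMul S X] [ContinuousSMul S X] [SMul T X] [SMulCommClass S T X]
    {φ : C(X, E)} {t : T} (h : ∀ x y, dist (φ (t • x)) (φ (t • y)) ≤ dist (φ x) (φ y)) (x y : X) :
    dist (orbitMap S φ (t • x)) (orbitMap S φ (t • y)) ≤
      dist (orbitMap S φ x) (orbitMap S φ y) :=
  dist_orbitMap_le ((h x y).trans (dist_le_dist_orbitMap φ x y)) fun s => by
    simpa only [smul_comm s t] using (h (s • x) (s • y)).trans (dist_smul_le_dist_orbitMap φ s x y)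

end OrbitMap

variable {X : Type u} [Semigroup X] [TopologicalSpace X] [CompactSpace X]

theorem exists_nonexpansiveMul_quotient {E : Type*} [MetricSpace E] (Φ : C(X, E))
    (hleft : ∀ a x y, dist (Φ (a * x)) (Φ (a * y)) ≤ dist (Φ x) (Φ y))
    (hright : ∀ a x y, dist (Φ (x * a)) (Φ (y * a)) ≤ dist (Φ x) (Φ y)) :
    ∃ (Y : Type u) (_ : Semigroup Y) (_ : MetricSpace Y) (π : X →ₙ* Y), CompactSpace Y ∧
      NonexpansiveMul Y ∧ Function.Surjective π ∧ ∀ x y, π x = π y ↔ Φ x = Φ y := by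
  let K : Con X :=
    { Setoid.ker Φ with
      mul' := fun {w x y z} (hwx : Φ w = Φ x) (hyz : Φ y = Φ z) => dist_le_zero.1 <|
        calc dist (Φ (w * y)) (Φ (x * z))
            ≤ dist (Φ (w * y)) (Φ (x * y)) + dist (Φ (x * y)) (Φ (x * z)) := dist_triangle _ _ _
          _ ≤ dist (Φ w) (Φ x) + dist (Φ y) (Φ z) := add_le_add (hright _ _ _) (hleft _ _ _)
          _ = 0 := by rw [hwx, hyz, dist_self, dist_self, add_zero] }
  let π : X →ₙ* K.Quotient := ⟨(↑), fun _ _ => rfl⟩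
  have hπ : Function.Surjective π := Quotient.mk''_surjective
  let Ψ : K.Quotient → E := Setoid.kerLift Φ
  let _ : MetricSpace K.Quotient := .induced Ψ (Setoid.kerLift_injective Φ) inferInstance
  have hcont : Continuous π := continuous_induced_rng.2 Φ.continuous
  refine ⟨K.Quotient, inferInstance, inferInstance, π, hπ.compactSpace hcont, ⟨?_, ?_⟩, hπ,
    fun x y => K.eq⟩
  · exact hπ.forall₃.2 hleft
  · exact hπ.forall₃.2 hright

theorem exists_nonexpansiveMul_quotient_separating [ContinuousMul X] {E : Type*} [MetricSpace E]
    (φ : C(X, E)) :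
    ∃ (Y : Type u) (_ : Semigroup Y) (_ : MetricSpace Y) (π : X →ₙ* Y), CompactSpace Y ∧
      NonexpansiveMul Y ∧ Function.Surjective π ∧ ∀ x y, π x = π y → φ x = φ y := by
  have : IsScalarTower Xᵐᵒᵖ Xᵐᵒᵖ X := ⟨fun _ _ _ => (mul_assoc _ _ _).symm⟩
  let Φ := orbitMap Xᵐᵒᵖ (orbitMap X φ)
  obtain ⟨Y, _, _, π, hY, hmul, hπ, hker⟩ := exists_nonexpansiveMul_quotient Φ
    (fun a => dist_orbitMap_smul_comm_le (dist_orbitMap_smul_le φ a))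
    fun a => dist_orbitMap_smul_le (orbitMap X φ) (MulOpposite.op a)
  exact ⟨Y, _, _, π, hY, hmul, hπ, fun x y h =>
    congrArg (fun e => e.1.1) ((hker x y).1 h)⟩

variable [T2Space X] [ContinuousMul X]

theorem exists_finite_separating {σ : Set (PolyWord ℕ × ℕ)} (hσ : σ.Finite)
    (h : ∀ g : ℕ → X, ∃ x, ∀ p ∈ σ, ev g p.1 x ≠ g p.2) :
    ∃ A : Set C(X, ℝ), A.Finite ∧
      ∀ g : ℕ → X, ∃ x, ∀ p ∈ σ, ∃ φ ∈ A, φ (ev g p.1 x) ≠ φ (g p.2) := by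
  choose x hx using h
  have hsep (g : ℕ → X) (p : σ) :
      ∃ φ : C(X, ℝ), φ (ev g p.1.1 (x g)) ≠ φ (g p.1.2) := by
    obtain ⟨φ, hφ, hne⟩ := separatesPoints_continuous_of_t35Space (hx g p p.2)
    exact ⟨⟨φ, hφ⟩, hne⟩
  choose φ hφ using hsep
  have := hσ.to_subtype
  let U (g : ℕ → X) : Set (ℕ → X) :=
    {g' | ∀ p, φ g p (ev g' p.1.1 (x g)) ≠ φ g p (g' p.1.2)}
  have hU (g : ℕ → X) : U g ∈ 𝓝 g := by
    refine eventually_all.2 fun p => ?_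
    have hcont : Continuous fun g' : ℕ → X => φ g p (ev g' p.1.1 (x g)) :=
      (φ g p).continuous.comp ((continuous_ev p.1.1).comp (.prodMk_left (x g)))
    have hopen := isOpen_ne_fun hcont ((φ g p).continuous.comp (continuous_apply p.1.2))
    exact hopen.mem_nhds (hφ g p)
  obtain ⟨t, -, ht⟩ := isCompact_univ.elim_nhds_subcover U fun g _ => hU g
  refine ⟨⋃ g ∈ t, range (φ g), t.finite_toSet.biUnion fun g _ => finite_range _, fun g' => ?_⟩
  obtain ⟨g, hg, hg'⟩ := mem_iUnion₂.1 (ht (mem_univ g'))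
  exact ⟨x g, fun p hp => ⟨φ g ⟨p, hp⟩, mem_biUnion hg (mem_range_self _), hg' ⟨p, hp⟩⟩⟩

theorem exists_countable_forall_finite_separating (hX : ¬ IsWordBounded X) :
    ∃ A : Set C(X, ℝ), A.Countable ∧ ∀ σ : Set (PolyWord ℕ × ℕ), σ.Finite → (∀ p ∈ σ, HasVar p.1) →
      ∀ g : ℕ → X, ∃ x, ∀ p ∈ σ, ∃ φ ∈ A, φ (ev g p.1 x) ≠ φ (g p.2) := by
  let 𝒮 : Set (Set (PolyWord ℕ × ℕ)) := {σ | σ.Finite ∧ ∀ p ∈ σ, HasVar p.1}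
  have h𝒮 : 𝒮.Countable := Countable.ofPred_finite.mono fun _ => And.left
  have hsep (σ : 𝒮) : ∃ A : Set C(X, ℝ), A.Finite ∧
      ∀ g : ℕ → X, ∃ x, ∀ p ∈ σ.1, ∃ φ ∈ A, φ (ev g p.1 x) ≠ φ (g p.2) :=
    exists_finite_separating σ.2.1 fun g => by
      by_contra! h
      exact hX (IsPolyCover.isWordBounded ⟨σ.2.2, h⟩ σ.2.1)
  choose A hA hsep using hsep
  have := h𝒮.to_subtype
  refine ⟨⋃ σ, A σ, countable_iUnion fun σ => (hA σ).countable, fun σ hσ hvar g => ?_⟩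
  obtain ⟨x, hx⟩ := hsep ⟨σ, hσ, hvar⟩ g
  exact ⟨x, fun p hp => (hx p hp).imp fun φ hφ => ⟨mem_iUnion_of_mem _ hφ.1, hφ.2⟩⟩

theorem isWordBounded_of_compactSpace (hcov : covMeager = continuum.{0})
    (hvan : ∀ F : Filter X, ¬ IsVanishing F) : IsWordBounded X := by
  rcases isEmpty_or_nonempty X with hempty | hne
  · exact ⟨∅, finite_empty, by simp, isEmptyElim⟩
  by_contra hX
  obtain ⟨A, hA, hsep⟩ := exists_countable_forall_finite_separating hX
  have := hA.to_subtype
  let _ := TopologicalSpace.metrizableSpaceMetric (A → ℝ)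
  let φ : C(X, A → ℝ) := ⟨fun x f => f.1 x, by fun_prop⟩
  obtain ⟨Y, _, _, π, _, _, hπ, hker⟩ := exists_nonexpansiveMul_quotient_separating φ
  have : SecondCountableTopology Y := EMetric.secondCountable_of_sigmaCompact Y
  have : Nonempty Y := hne.map π
  obtain ⟨g, σ, hσ, hvar, hcover⟩ := (isWordBounded_of_completeSpace (M := Y) hcov
    fun F hF => hvan _ (hF.comap π hπ)).exists_isPolyCover_nat
  obtain ⟨g, rfl⟩ := hπ.comp_left g
  obtain ⟨x, hx⟩ := hsep σ hσ hvar g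
  obtain ⟨p, hp, hpx⟩ := hcover (π x)
  obtain ⟨f, hf, hne⟩ := hx p hp
  exact hne (congrFun (hker _ _ ((map_ev π g p.1 x).trans hpx)) ⟨f, hf⟩)

end Compact

theorem mainTheorem2 {X : Type u} [Semigroup X] (hcov : covMeager = Cardinal.continuum.{0})
    (hX : IsZeroClosed X)
    (h : HasSeparableCompleteSubinvariantMetric X ∨ AdmitsCompactHausdorffSemigroupTopology X) :
    IsPolybounded X := by
  have hvan (F : Filter X) : ¬ IsVanishing F := fun hF => hF.not_isZeroClosed hX
  rcases h with ⟨_, _, _, hsub⟩ | ⟨_, _, _, _⟩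
  · have := hsub.nonexpansiveMul
    exact (isWordBounded_of_completeSpace hcov hvan).isPolybounded
  · exact (isWordBounded_of_compactSpace hcov hvan).isPolybounded
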